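/- Let $N\ge 3$ be an integer and let $B_1$ be the open unit ball of $\mathbb{R}^N$. Write $w_{rr}(x)=\sum_{i,j=1}^N \frac{x_i x_j}{|x|^2}\,w_{x_i x_j}(x)$ for $x\neq 0$. Suppose that either (1) $0<\gamma<N-2$ and $1<p<\frac{N+2+3\gamma}{N-2-\gamma}$, or (2) $\gamma\ge N-2$ and $1<p<\infty$. Then there is a function $w\in C^\infty(B_1)\cap C^2(\overline{B_1})$ that is positive in $B_1$, radial and strictly decreasing in $|x|$ on $\overline{B_1}$, and that satisfies $$-\Delta w-\gamma\,w_{rr}=w^p\ \text{ in } B_1\setminus\{0\},\qquad w=0\ \text{ on }\partial B_1 .$$ -/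

import Mathlib

open Metric
open scoped ContDiff

noncomputable section

/-- The second order partial derivative `u_{x_i x_j}` at `x`. -/
def secondPartial {N : ℕ} (u : EuclideanSpace ℝ (Fin N) → ℝ) (i j : Fin N)
    (x : EuclideanSpace ℝ (Fin N)) : ℝ :=
  iteratedFDeriv ℝ 2 u x ![EuclideanSpace.single i 1, EuclideanSpace.single j 1]

/-- The operator `L_γ u = Δ u + γ ∑_{i,j} (x_i x_j / |x|²) u_{x_i x_j}`, that is `Δ u + γ u_rr`;
it is meant for `x ≠ 0` only. -/
def cordesOp {N : ℕ} (γ : ℝ) (u : EuclideanSpace ℝ (Fin N) → ℝ)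
    (x : EuclideanSpace ℝ (Fin N)) : ℝ :=
  Laplacian.laplacian u x
    + γ * ∑ i : Fin N, ∑ j : Fin N, x i * x j / ‖x‖ ^ 2 * secondPartial u i j x

/-- `w` is a positive, smooth, radially decreasing (classical) solution of
`-Δ w - γ w_rr = w ^ p` in `B_1 \ {0}`, `w = 0` on `∂B_1`.
Only the values of `w` on the closed unit ball matter. -/
structure IsPosSmoothRadialDecSolution (N : ℕ) (γ p : ℝ)
    (w : EuclideanSpace ℝ (Fin N) → ℝ) : Prop where
  /-- `w` is smooth in the open ball, origin included. -/
  smooth : ContDiffOn ℝ ∞ w (ball 0 1)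
  /-- `w` is `C²` up to the boundary. -/
  contDiffOn_closedBall : ContDiffOn ℝ 2 w (closedBall 0 1)
  pos : ∀ x ∈ ball (0 : EuclideanSpace ℝ (Fin N)) 1, 0 < w x
  radial_decreasing : ∃ v : ℝ → ℝ, StrictAntiOn v (Set.Icc 0 1) ∧
    ∀ x ∈ closedBall (0 : EuclideanSpace ℝ (Fin N)) 1, w x = v ‖x‖
  equation : ∀ x ∈ ball (0 : EuclideanSpace ℝ (Fin N)) 1, x ≠ 0 → -cordesOp γ w x = w x ^ p
  boundary : ∀ x ∈ sphere (0 : EuclideanSpace ℝ (Fin N)) 1, w x = 0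

end

/-!
In the variable `s = |x| ^ 2` a radial function `w x = g (|x| ^ 2)` solves the equation if and only
if `s g'' + a g' = -b g ^ p` with `a = (N + γ) / (2 (1 + γ))` and `b = 1 / (4 (1 + γ))`, and the
assumption on `p` amounts to `a (p - 1) < p + 1`. Scaling reduces the problem to `b = 1` and
`g 0 = 1`, with the first zero of `g` anywhere.

The equation is equivalent to `g' s = -∫ τ in 0..1, τ ^ (a - 1) * g (s τ) ^ p`, which is regular at
`s = 0` and meaningful for negative `s` too. With the power replaced by a Lipschitz truncation it is
solved on all of `ℝ` by a contraction in an exponentially weighted sup norm, and since the averages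
on the right inherit the regularity of `g`, the solution is smooth as long as it is positive.

If `g` were positive on `[0, ∞)`, then `g' ≤ -g ^ p / a` would give `s g ^ (p - 1) ≤ a / (p - 1)`,
and monotonicity of `s ^ a g'` would give `s |g'| ≤ 2 ^ a g`. Under these bounds the Pohozaev
functional tends to `0` at infinity for subcritical `p`; but it vanishes at `0` and is strictly
increasing.
-/

open MeasureTheory Set Filter
open scoped Topology NNReal Interval RealInnerProductSpace

section Volterra

variable {E : Type*} [NormedAddCommGroup E]

/-- An operator `H` on functions `ℝ → E` which preserves continuity and is causal and Lipschitz: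
`H u t` depends only on the values of `u` on `[-|t|, |t|]`, in a Lipschitz way for the sup norm
on that interval. -/
structure IsLipschitzVolterra (M : ℝ) (H : (ℝ → E) → ℝ → E) : Prop where
  continuous : ∀ u, Continuous u → Continuous (H u)
  norm_sub_le : ∀ u v, Continuous u → Continuous v → ∀ t D : ℝ,
    (∀ x, |x| ≤ |t| → ‖u x - v x‖ ≤ D) → ‖H u t - H v t‖ ≤ M * D

theorem IsLipschitzVolterra.nonneg {M : ℝ} {H : (ℝ → E) → ℝ → E}
    (hH : IsLipschitzVolterra M H) : 0 ≤ M := by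
  simpa using hH.norm_sub_le 0 0 continuous_zero continuous_zero 0 1 (by simp)

variable [NormedSpace ℝ E]

theorem norm_integral_le_of_norm_le_mul_exp {f : ℝ → E} {B K : ℝ} (hK : 0 < K)
    (hf : ∀ t, ‖f t‖ ≤ B * Real.exp (K * |t|)) (s : ℝ) :
    ‖∫ t in (0 : ℝ)..s, f t‖ ≤ B / K * Real.exp (K * |s|) := by
  have hB : 0 ≤ B := by simpa using (norm_nonneg _).trans (hf 0)
  have hprimitive (τ : ℝ) : HasDerivAt (fun τ => B / K * Real.exp (K * |s| * τ))
      (|s| * (B * Real.exp (K * |s| * τ))) τ := by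
    refine (((hasDerivAt_id τ).const_mul (K * |s|)).exp.const_mul (B / K)).congr_deriv ?_
    simp only [id]
    field_simp
  have hInt : IntervalIntegrable (fun τ => |s| * (B * Real.exp (K * |s| * τ))) volume 0 1 :=
    Continuous.intervalIntegrable (by fun_prop) _ _
  calc ‖∫ t in (0 : ℝ)..s, f t‖ = ‖∫ τ in (0 : ℝ)..1, s • f (s * τ)‖ := by
        rw [intervalIntegral.integral_smul, intervalIntegral.smul_integral_comp_mul_left]
        simp
    _ ≤ ∫ τ in (0 : ℝ)..1, |s| * (B * Real.exp (K * |s| * τ)) := by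
        refine intervalIntegral.norm_integral_le_of_norm_le zero_le_one
          (Eventually.of_forall fun τ hτ => ?_) hInt
        rw [norm_smul, Real.norm_eq_abs]
        refine mul_le_mul_of_nonneg_left ((hf _).trans_eq ?_) (abs_nonneg _)
        rw [abs_mul, abs_of_pos hτ.1, mul_assoc]
    _ = B / K * Real.exp (K * |s|) - B / K := by
        rw [intervalIntegral.integral_eq_sub_of_hasDerivAt (fun τ _ => hprimitive τ) hInt]
        simp
    _ ≤ B / K * Real.exp (K * |s|) := sub_le_self _ (by positivity)

/-- The Picard map of the equation `g' = H g` with initial value `c`. -/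
noncomputable def picardMap (H : (ℝ → E) → ℝ → E) (c : E) (u : ℝ → E) (s : ℝ) : E :=
  c + ∫ t in (0 : ℝ)..s, H u t

theorem norm_picardMap_zero_le {H : (ℝ → E) → ℝ → E} {C K : ℝ} (hH₀ : ∀ t, ‖H 0 t‖ ≤ C)
    (hK : 0 < K) (c : E) (s : ℝ) :
    ‖picardMap H c 0 s‖ ≤ (‖c‖ + C / K) * Real.exp (K * |s|) := by
  have hC : 0 ≤ C := (norm_nonneg _).trans (hH₀ 0)
  have hexp (t : ℝ) : 1 ≤ Real.exp (K * |t|) := Real.one_le_exp (by positivity)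
  have hInt := norm_integral_le_of_norm_le_mul_exp hK
    (fun t => (hH₀ t).trans (le_mul_of_one_le_right hC (hexp t))) s
  calc ‖picardMap H c 0 s‖ ≤ ‖c‖ + C / K * Real.exp (K * |s|) :=
        (norm_add_le _ _).trans (by gcongr)
    _ ≤ ‖c‖ * Real.exp (K * |s|) + C / K * Real.exp (K * |s|) := by
        gcongr
        exact le_mul_of_one_le_right (norm_nonneg _) (hexp s)
    _ = (‖c‖ + C / K) * Real.exp (K * |s|) := by ring

namespace IsLipschitzVolterra

variable {M : ℝ} {H : (ℝ → E) → ℝ → E}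

theorem hasDerivAt_picardMap [CompleteSpace E] (hH : IsLipschitzVolterra M H) (c : E)
    {u : ℝ → E} (hu : Continuous u) (s : ℝ) :
    HasDerivAt (picardMap H c u) (H u s) s :=
  ((hH.continuous u hu).integral_hasStrictDerivAt 0 s).hasDerivAt.const_add c

theorem norm_picardMap_sub_le (hH : IsLipschitzVolterra M H) (c : E) {u v : ℝ → E}
    (hu : Continuous u) (hv : Continuous v) {D K : ℝ} (hK : 0 < K)
    (huv : ∀ x, ‖u x - v x‖ ≤ D * Real.exp (K * |x|)) (s : ℝ) :
    ‖picardMap H c u s - picardMap H c v s‖ ≤ M * D / K * Real.exp (K * |s|) := by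
  have hD : 0 ≤ D := by simpa using (norm_nonneg _).trans (huv 0)
  have hbound (t : ℝ) : ‖H u t - H v t‖ ≤ M * D * Real.exp (K * |t|) := by
    rw [mul_assoc]
    refine hH.norm_sub_le u v hu hv t _ fun x hx => (huv x).trans ?_
    gcongr
  rw [picardMap, picardMap, add_sub_add_left_eq_sub, ← intervalIntegral.integral_sub
    ((hH.continuous u hu).intervalIntegrable _ _) ((hH.continuous v hv).intervalIntegrable _ _)]
  exact norm_integral_le_of_norm_le_mul_exp hK hbound s

end IsLipschitzVolterra

/-- The function `t ↦ e ^ (K |t|) u t`; for `K > 0` it identifies bounded functions with those of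
exponential growth rate `K`. -/
noncomputable def expWeight (K : ℝ) (u : ℝ → E) (t : ℝ) : E :=
  Real.exp (K * |t|) • u t

theorem continuous_expWeight (K : ℝ) {u : ℝ → E} (hu : Continuous u) :
    Continuous (expWeight K u) := by
  unfold expWeight
  fun_prop

theorem expWeight_expWeight_neg (K : ℝ) (u : ℝ → E) : expWeight K (expWeight (-K) u) = u := by
  ext t
  simp [expWeight, smul_smul, ← Real.exp_add]

theorem norm_expWeight_neg_le {K B : ℝ} {u : ℝ → E} {t : ℝ}
    (hu : ‖u t‖ ≤ B * Real.exp (K * |t|)) : ‖expWeight (-K) u t‖ ≤ B := by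
  rw [expWeight, norm_smul, Real.norm_of_nonneg (Real.exp_pos _).le, neg_mul, Real.exp_neg,
    inv_mul_le_iff₀ (Real.exp_pos _), mul_comm]
  exact hu

theorem norm_expWeight_sub_le (K : ℝ) (u v : BoundedContinuousFunction ℝ E) (t : ℝ) :
    ‖expWeight K u t - expWeight K v t‖ ≤ dist u v * Real.exp (K * |t|) := by
  rw [expWeight, expWeight, ← smul_sub, norm_smul, Real.norm_of_nonneg (Real.exp_pos _).le,
    mul_comm, ← dist_eq_norm]
  gcongr
  exact BoundedContinuousFunction.dist_coe_le_dist t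

namespace IsLipschitzVolterra

variable {M : ℝ} {H : (ℝ → E) → ℝ → E}

theorem norm_expWeight_picardMap_le (hH : IsLipschitzVolterra M H) {C : ℝ}
    (hH₀ : ∀ t, ‖H 0 t‖ ≤ C) (c : E) {K : ℝ} (hK : 0 < K)
    (u : BoundedContinuousFunction ℝ E) (s : ℝ) :
    ‖expWeight (-K) (picardMap H c (expWeight K u)) s‖ ≤ M * ‖u‖ / K + (‖c‖ + C / K) := by
  refine norm_expWeight_neg_le ?_
  have hu (t : ℝ) : ‖expWeight K u t - (0 : ℝ → E) t‖ ≤ ‖u‖ * Real.exp (K * |t|) := by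
    simpa [expWeight] using norm_expWeight_sub_le K u 0 t
  have hsub := hH.norm_picardMap_sub_le c (continuous_expWeight K u.continuous) continuous_zero
    hK hu s
  rw [add_mul]
  exact (norm_le_norm_sub_add _ _).trans (add_le_add hsub (norm_picardMap_zero_le hH₀ hK c s))

variable [CompleteSpace E]

/-- The Picard map, conjugated by the exponential weight so that it acts on bounded functions. -/
noncomputable def weightedPicard (hH : IsLipschitzVolterra M H) {C : ℝ} (hH₀ : ∀ t, ‖H 0 t‖ ≤ C)
    (c : E) {K : ℝ} (hK : 0 < K) (u : BoundedContinuousFunction ℝ E) :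
    BoundedContinuousFunction ℝ E :=
  BoundedContinuousFunction.ofNormedAddCommGroup
    (expWeight (-K) (picardMap H c (expWeight K u)))
    (continuous_expWeight _ <| continuous_iff_continuousAt.2 fun s =>
      (hH.hasDerivAt_picardMap c (continuous_expWeight K u.continuous) s).continuousAt)
    _ (hH.norm_expWeight_picardMap_le hH₀ c hK u)

theorem dist_weightedPicard_le (hH : IsLipschitzVolterra M H) {C : ℝ} (hH₀ : ∀ t, ‖H 0 t‖ ≤ C)
    (c : E) {K : ℝ} (hK : 0 < K) (u v : BoundedContinuousFunction ℝ E) :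
    dist (hH.weightedPicard hH₀ c hK u) (hH.weightedPicard hH₀ c hK v) ≤ M / K * dist u v := by
  have hM := hH.nonneg
  rw [BoundedContinuousFunction.dist_le (by positivity)]
  intro s
  have hsub := hH.norm_picardMap_sub_le c (continuous_expWeight K u.continuous)
    (continuous_expWeight K v.continuous) hK (norm_expWeight_sub_le K u v) s
  rw [← mul_div_right_comm, dist_eq_norm]
  calc ‖hH.weightedPicard hH₀ c hK u s - hH.weightedPicard hH₀ c hK v s‖
      = ‖expWeight (-K) (fun t => picardMap H c (expWeight K u) t -
          picardMap H c (expWeight K v) t) s‖ := by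
        simp only [expWeight, smul_sub]
        rfl
    _ ≤ M * dist u v / K := norm_expWeight_neg_le hsub

theorem exists_hasDerivAt (hH : IsLipschitzVolterra M H) {C : ℝ} (hH₀ : ∀ t, ‖H 0 t‖ ≤ C)
    (c : E) : ∃ g : ℝ → E, g 0 = c ∧ ∀ s, HasDerivAt g (H g s) s := by
  have hM := hH.nonneg
  have hK : 0 < M + 1 := by positivity
  have hcontracting : ContractingWith (M / (M + 1)).toNNReal (hH.weightedPicard hH₀ c hK) := by
    refine ⟨by simp [div_lt_one hK], LipschitzWith.of_dist_le_mul fun u v => ?_⟩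
    rw [Real.coe_toNNReal _ (by positivity)]
    exact hH.dist_weightedPicard_le hH₀ c hK u v
  obtain ⟨u, hu, -⟩ := hcontracting.exists_fixedPoint 0 (edist_ne_top _ _)
  set g := expWeight (M + 1) u with hg
  have hfix : picardMap H c g = g := by
    conv_rhs => rw [hg, ← hu.eq]
    exact (expWeight_expWeight_neg _ _).symm
  refine ⟨g, by rw [← hfix]; simp [picardMap], fun s => ?_⟩
  have hderiv := hH.hasDerivAt_picardMap c (continuous_expWeight (M + 1) u.continuous) s
  rwa [← hg, hfix] at hderiv

end IsLipschitzVolterra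

end Volterra

section WeightedMean

/-- The mean `∫₀¹ τ ^ (a - 1) φ (s τ) dτ`, which equals `s ^ (-a) ∫₀ˢ t ^ (a - 1) φ t dt` for
`s > 0` but makes sense, and is as smooth as `φ`, on both sides of the origin. With
`h = weightedMean a φ` one has `s h' + a h = φ`. -/
noncomputable def weightedMean (a : ℝ) (φ : ℝ → ℝ) (s : ℝ) : ℝ :=
  ∫ τ in (0 : ℝ)..1, τ ^ (a - 1) * φ (s * τ)

variable {a : ℝ} {φ ψ : ℝ → ℝ} {s : ℝ}

theorem intervalIntegrable_rpow_sub_one_mul (ha : 0 < a) (hψ : ContinuousOn ψ (Icc 0 1)) :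
    IntervalIntegrable (fun τ => τ ^ (a - 1) * ψ τ) volume 0 1 := by
  refine (intervalIntegral.intervalIntegrable_rpow' (by linarith)).mul_continuousOn ?_
  rwa [uIcc_of_le zero_le_one]

theorem weightedMean_const (ha : 0 < a) (c s : ℝ) : weightedMean a (fun _ => c) s = c / a := by
  rw [weightedMean, intervalIntegral.integral_mul_const, integral_rpow (Or.inl (by linarith))]
  simp [Real.zero_rpow ha.ne', div_eq_inv_mul]

theorem weightedMean_nonneg (h : ∀ t, 0 ≤ φ t) : 0 ≤ weightedMean a φ s :=
  intervalIntegral.integral_nonneg zero_le_one fun _ hτ =>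
    mul_nonneg (Real.rpow_nonneg hτ.1 _) (h _)

theorem weightedMean_pos (ha : 0 < a) (hφ : ContinuousOn (fun τ => φ (s * τ)) (Icc 0 1))
    (h : ∀ τ ∈ Ioo (0 : ℝ) 1, 0 < φ (s * τ)) : 0 < weightedMean a φ s :=
  intervalIntegral.intervalIntegral_pos_of_pos_on (intervalIntegrable_rpow_sub_one_mul ha hφ)
    (fun τ hτ => mul_pos (Real.rpow_pos_of_pos hτ.1 _) (h τ hτ)) zero_lt_one

theorem norm_rpow_sub_one_mul_le {τ y M : ℝ} (hτ : 0 ≤ τ) (hy : |y| ≤ M) :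
    ‖τ ^ (a - 1) * y‖ ≤ τ ^ (a - 1) * M := by
  rw [norm_mul, Real.norm_of_nonneg (Real.rpow_nonneg hτ _)]
  exact mul_le_mul_of_nonneg_left hy (Real.rpow_nonneg hτ _)

theorem abs_weightedMean_sub_le (ha : 0 < a) {D : ℝ}
    (hφ : ContinuousOn (fun τ => φ (s * τ)) (Icc 0 1))
    (hψ : ContinuousOn (fun τ => ψ (s * τ)) (Icc 0 1))
    (h : ∀ τ ∈ Icc (0 : ℝ) 1, |φ (s * τ) - ψ (s * τ)| ≤ D) :
    |weightedMean a φ s - weightedMean a ψ s| ≤ D / a := by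
  rw [← Real.norm_eq_abs, ← weightedMean_const ha D s, weightedMean, weightedMean,
    ← intervalIntegral.integral_sub (intervalIntegrable_rpow_sub_one_mul ha hφ)
      (intervalIntegrable_rpow_sub_one_mul ha hψ)]
  refine intervalIntegral.norm_integral_le_of_norm_le zero_le_one
    (Eventually.of_forall fun τ hτ => ?_)
    (intervalIntegrable_rpow_sub_one_mul ha continuousOn_const)
  rw [← mul_sub]
  exact norm_rpow_sub_one_mul_le hτ.1.le (h τ (Ioc_subset_Icc_self hτ))

variable {I : Set ℝ}

theorem mul_mem_of_starConvex (hI : StarConvex ℝ 0 I) {τ : ℝ} (hs : s ∈ I)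
    (hτ : τ ∈ Icc (0 : ℝ) 1) : s * τ ∈ I := by
  simpa [mul_comm] using hI.smul_mem hs hτ.1 hτ.2

theorem continuousOn_comp_mul_of_starConvex (hI : StarConvex ℝ 0 I) (hφ : ContinuousOn φ I)
    (hs : s ∈ I) : ContinuousOn (fun τ => φ (s * τ)) (Icc 0 1) :=
  hφ.comp (by fun_prop) fun _ hτ => mul_mem_of_starConvex hI hs hτ

theorem exists_eventually_abs_comp_mul_le (hIo : IsOpen I) (hI : StarConvex ℝ 0 I)
    (hφ : ContinuousOn φ I) (hs : s ∈ I) :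
    ∃ M, ∀ᶠ x in 𝓝 s, x ∈ I ∧ ∀ τ ∈ Icc (0 : ℝ) 1, |φ (x * τ)| ≤ M := by
  obtain ⟨δ, hδ, hball⟩ := Metric.nhds_basis_closedBall.mem_iff.1 (hIo.mem_nhds hs)
  have hcompact : IsCompact (closedBall s δ ×ˢ Icc (0 : ℝ) 1) :=
    (isCompact_closedBall s δ).prod isCompact_Icc
  obtain ⟨M, hM⟩ := hcompact.exists_bound_of_continuousOn (f := fun q => φ (q.1 * q.2))
    (hφ.comp (by fun_prop) fun q hq => mul_mem_of_starConvex hI (hball hq.1) hq.2)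
  refine ⟨M, ?_⟩
  filter_upwards [closedBall_mem_nhds s hδ] with x hx
  exact ⟨hball hx, fun τ hτ => hM (x, τ) ⟨hx, hτ⟩⟩

theorem continuousOn_weightedMean (ha : 0 < a) (hIo : IsOpen I) (hI : StarConvex ℝ 0 I)
    (hφ : ContinuousOn φ I) : ContinuousOn (weightedMean a φ) I := by
  intro s hs
  obtain ⟨M, hM⟩ := exists_eventually_abs_comp_mul_le hIo hI hφ hs
  refine (intervalIntegral.continuousAt_of_dominated_interval
    (bound := fun τ => τ ^ (a - 1) * M) ?_ ?_
    (intervalIntegrable_rpow_sub_one_mul ha continuousOn_const) ?_).continuousWithinAt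
  · filter_upwards [hIo.mem_nhds hs] with x hx
    exact (intervalIntegrable_rpow_sub_one_mul ha
      (continuousOn_comp_mul_of_starConvex hI hφ hx)).aestronglyMeasurable_restrict_uIoc
  · filter_upwards [hM] with x hx
    refine Eventually.of_forall fun τ hτ => ?_
    rw [uIoc_of_le zero_le_one] at hτ
    exact norm_rpow_sub_one_mul_le hτ.1.le (hx.2 τ (Ioc_subset_Icc_self hτ))
  · refine Eventually.of_forall fun τ hτ => ?_
    rw [uIoc_of_le zero_le_one] at hτ
    have hmem := mul_mem_of_starConvex hI hs (Ioc_subset_Icc_self hτ)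
    exact continuousAt_const.mul (ContinuousAt.comp (f := fun x => x * τ)
      (hφ.continuousAt (hIo.mem_nhds hmem)) (by fun_prop))

theorem continuous_weightedMean (ha : 0 < a) (hφ : Continuous φ) :
    Continuous (weightedMean a φ) :=
  continuousOn_univ.1
    (continuousOn_weightedMean ha isOpen_univ (starConvex_univ 0) hφ.continuousOn)

theorem hasDerivAt_of_contDiffOn_one (hIo : IsOpen I) (hφ : ContDiffOn ℝ 1 φ I) (hs : s ∈ I) :
    HasDerivAt φ (deriv φ s) s :=
  ((hφ.differentiableOn one_ne_zero).differentiableAt (hIo.mem_nhds hs)).hasDerivAt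

theorem hasDerivAt_weightedMean (ha : 0 < a) (hIo : IsOpen I) (hI : StarConvex ℝ 0 I)
    (hφ : ContDiffOn ℝ 1 φ I) (hs : s ∈ I) :
    HasDerivAt (weightedMean a φ) (weightedMean (a + 1) (deriv φ) s) s := by
  have hφ' : ContinuousOn (deriv φ) I := hφ.continuousOn_deriv_of_isOpen hIo le_rfl
  obtain ⟨M, hM⟩ := exists_eventually_abs_comp_mul_le hIo hI hφ' hs
  have hInt (x : ℝ) (hx : x ∈ I) :
      IntervalIntegrable (fun τ => τ ^ (a - 1) * φ (x * τ)) volume 0 1 :=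
    intervalIntegrable_rpow_sub_one_mul ha
      (continuousOn_comp_mul_of_starConvex hI hφ.continuousOn hx)
  have hInt' : IntervalIntegrable (fun τ => τ ^ (a - 1) * (deriv φ (s * τ) * τ)) volume 0 1 :=
    intervalIntegrable_rpow_sub_one_mul ha
      ((continuousOn_comp_mul_of_starConvex hI hφ' hs).mul continuousOn_id)
  have hmain := (intervalIntegral.hasDerivAt_integral_of_dominated_loc_of_deriv_le
    (F := fun x τ => τ ^ (a - 1) * φ (x * τ))
    (F' := fun x τ => τ ^ (a - 1) * (deriv φ (x * τ) * τ))
    (bound := fun τ => τ ^ (a - 1) * M) hM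
    (eventually_of_mem (hIo.mem_nhds hs) fun x hx => (hInt x hx).aestronglyMeasurable_restrict_uIoc)
    (hInt s hs) hInt'.aestronglyMeasurable_restrict_uIoc
    (Eventually.of_forall fun τ hτ x hx => ?bound)
    (intervalIntegrable_rpow_sub_one_mul ha continuousOn_const)
    (Eventually.of_forall fun τ hτ x hx => ?deriv)).2
  case bound =>
    rw [uIoc_of_le zero_le_one] at hτ
    refine norm_rpow_sub_one_mul_le hτ.1.le ?_
    rw [abs_mul, abs_of_pos hτ.1]
    exact (mul_le_of_le_one_right (abs_nonneg _) hτ.2).trans (hx.2 τ (Ioc_subset_Icc_self hτ))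
  case deriv =>
    rw [uIoc_of_le zero_le_one] at hτ
    have hmem := mul_mem_of_starConvex hI hx.1 (Ioc_subset_Icc_self hτ)
    have hcomp := (hasDerivAt_of_contDiffOn_one hIo hφ hmem).comp x (hasDerivAt_mul_const τ)
    exact hcomp.const_mul (τ ^ (a - 1))
  refine hmain.congr_deriv
    (intervalIntegral.integral_congr_ae (Eventually.of_forall fun τ hτ => ?_))
  rw [uIoc_of_le zero_le_one] at hτ
  rw [add_sub_right_comm, Real.rpow_add_one hτ.1.ne']
  ring

theorem contDiffOn_weightedMean (hIo : IsOpen I) (hI : StarConvex ℝ 0 I) (ha : 0 < a) {n : ℕ}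
    (hφ : ContDiffOn ℝ n φ I) : ContDiffOn ℝ n (weightedMean a φ) I := by
  induction n generalizing a φ with
  | zero =>
    simp only [Nat.cast_zero, contDiffOn_zero] at hφ ⊢
    exact continuousOn_weightedMean ha hIo hI hφ
  | succ n ih =>
    have hderiv (s : ℝ) (hs : s ∈ I) := hasDerivAt_weightedMean ha hIo hI
      (hφ.of_le (by exact_mod_cast n.succ_pos)) hs
    rw [Nat.cast_succ, contDiffOn_succ_iff_deriv_of_isOpen hIo] at hφ ⊢
    exact ⟨fun s hs => (hderiv s hs).differentiableAt.differentiableWithinAt, by simp,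
      (ih (by positivity) hφ.2.2).congr fun s hs => (hderiv s hs).deriv⟩

theorem mul_deriv_weightedMean_add (ha : 0 < a) (hIo : IsOpen I) (hI : StarConvex ℝ 0 I)
    (hφ : ContDiffOn ℝ 1 φ I) (hs : s ∈ I) :
    s * deriv (weightedMean a φ) s + a * weightedMean a φ s = φ s := by
  have hφs := continuousOn_comp_mul_of_starConvex hI hφ.continuousOn hs
  have hInt' := (intervalIntegrable_rpow_sub_one_mul (a := a + 1) (by positivity)
    (continuousOn_comp_mul_of_starConvex hI
      (hφ.continuousOn_deriv_of_isOpen hIo le_rfl) hs)).const_mul s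
  have hInt := (intervalIntegrable_rpow_sub_one_mul ha hφs).const_mul a
  have hderiv (τ : ℝ) (hτ : τ ∈ Ioo 0 1) : HasDerivAt (fun τ => τ ^ a * φ (s * τ))
      (s * (τ ^ (a + 1 - 1) * deriv φ (s * τ)) + a * (τ ^ (a - 1) * φ (s * τ))) τ := by
    have hmem := mul_mem_of_starConvex hI hs (Ioo_subset_Icc_self hτ)
    have hcomp := (hasDerivAt_of_contDiffOn_one hIo hφ hmem).comp τ (hasDerivAt_const_mul s)
    refine ((Real.hasDerivAt_rpow_const (p := a) (Or.inl hτ.1.ne')).mul hcomp).congr_deriv ?_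
    rw [add_sub_cancel_right, Function.comp_apply]
    ring
  have hftc := intervalIntegral.integral_eq_sub_of_hasDerivAt_of_le zero_le_one
    ((Real.continuous_rpow_const ha.le).continuousOn.mul hφs) hderiv (hInt'.add hInt)
  rw [intervalIntegral.integral_add hInt' hInt, intervalIntegral.integral_const_mul,
    intervalIntegral.integral_const_mul] at hftc
  rw [(hasDerivAt_weightedMean ha hIo hI hφ hs).deriv]
  simpa [Real.zero_rpow ha.ne', weightedMean] using hftc

theorem isLipschitzVolterra_neg_weightedMean_comp (ha : 0 < a) {F : ℝ → ℝ} {L : ℝ≥0}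
    (hF : LipschitzWith L F) :
    IsLipschitzVolterra (L / a) fun u s => -weightedMean a (F ∘ u) s where
  continuous u hu := (continuous_weightedMean ha (hF.continuous.comp hu)).neg
  norm_sub_le u v hu hv t D huv := by
    have hF' := hF.continuous
    rw [neg_sub_neg, norm_sub_rev, div_mul_eq_mul_div]
    refine abs_weightedMean_sub_le ha (by fun_prop) (by fun_prop) fun τ hτ => ?_
    have hle : |t * τ| ≤ |t| := by
      rw [abs_mul, abs_of_nonneg hτ.1]
      exact mul_le_of_le_one_right (abs_nonneg t) hτ.2
    exact (hF.dist_le_mul _ _).trans (by gcongr; exact huv _ hle)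

theorem exists_hasDerivAt_neg_weightedMean_comp (ha : 0 < a) {F : ℝ → ℝ} {L : ℝ≥0}
    (hF : LipschitzWith L F) (c : ℝ) :
    ∃ g : ℝ → ℝ, g 0 = c ∧ ∀ s, HasDerivAt g (-weightedMean a (F ∘ g) s) s := by
  refine (isLipschitzVolterra_neg_weightedMean_comp ha hF).exists_hasDerivAt
    (C := |F 0 / a|) (fun t => ?_) c
  rw [norm_neg, Real.norm_eq_abs, ← weightedMean_const ha (F 0) t]
  rfl

variable {f g : ℝ → ℝ} {U : Set ℝ}

theorem contDiffOn_succ_of_hasDerivAt_neg_weightedMean (ha : 0 < a) (hIo : IsOpen I)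
    (hI : StarConvex ℝ 0 I) (hg : ∀ s ∈ I, HasDerivAt g (-weightedMean a (f ∘ g) s) s)
    (hgU : MapsTo g I U) {n : ℕ} (hf : ContDiffOn ℝ n f U) : ContDiffOn ℝ (n + 1) g I := by
  have hstep (k : ℕ) (hk : k ≤ n) (hgk : ContDiffOn ℝ k g I) : ContDiffOn ℝ (k + 1) g I := by
    rw [contDiffOn_succ_iff_deriv_of_isOpen hIo]
    refine ⟨fun s hs => (hg s hs).differentiableAt.differentiableWithinAt, by simp, ?_⟩
    refine ContDiffOn.congr ?_ fun s hs => (hg s hs).deriv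
    exact (contDiffOn_weightedMean hIo hI ha
      ((hf.of_le (by exact_mod_cast hk)).comp hgk hgU)).neg
  have hall (k : ℕ) (hk : k ≤ n) : ContDiffOn ℝ k g I := by
    induction k with
    | zero =>
      exact contDiffOn_zero.2 fun s hs => (hg s hs).continuousAt.continuousWithinAt
    | succ k ih => exact_mod_cast hstep k (by lia) (ih (by lia))
  exact hstep n le_rfl (hall n le_rfl)

theorem mul_deriv_deriv_add_of_hasDerivAt_neg_weightedMean (ha : 0 < a) (hIo : IsOpen I)
    (hI : StarConvex ℝ 0 I) (hg : ∀ s ∈ I, HasDerivAt g (-weightedMean a (f ∘ g) s) s)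
    (hgU : MapsTo g I U) (hf : ContDiffOn ℝ 1 f U) (hs : s ∈ I) :
    s * deriv (deriv g) s + a * deriv g s = -f (g s) := by
  have hg1 : ContDiffOn ℝ 1 g I := by
    simpa using contDiffOn_succ_of_hasDerivAt_neg_weightedMean (n := 0) ha hIo hI hg hgU
      (hf.of_le zero_le_one)
  have hderiv : deriv g =ᶠ[𝓝 s] fun t => -weightedMean a (f ∘ g) t :=
    eventually_of_mem (hIo.mem_nhds hs) fun t ht => (hg t ht).deriv
  have hode := mul_deriv_weightedMean_add ha hIo hI (hf.comp hg1 hgU) hs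
  rw [hderiv.deriv_eq, hderiv.eq_of_nhds, deriv.fun_neg, ← Function.comp_apply (f := f), ← hode]
  ring

end WeightedMean

section GlobalPositiveSolutions

/-- A positive solution of the Lane–Emden equation `s g'' + a g' = -g ^ p` on the whole half-line
`[0, ∞)`. In the variable `s = r ^ 2` this is the equation of entire radial solutions; being twice
differentiable at `s = 0` encodes regularity at the origin. -/
structure IsGlobalPosLaneEmdenSolution (a p : ℝ) (g : ℝ → ℝ) : Prop where
  contDiffAt : ∀ s, 0 ≤ s → ContDiffAt ℝ 2 g s
  pos : ∀ s, 0 ≤ s → 0 < g s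
  ode : ∀ s, 0 < s → s * deriv (deriv g) s + a * deriv g s = -g s ^ p

/-- The Pohozaev functional of the Lane–Emden equation `s g'' + a g' = -g ^ p`. Its derivative along
a solution is a multiple of `s ^ a g' ^ 2`, positive exactly in the subcritical range
`a (p - 1) < p + 1`. -/
noncomputable def pohozaev (a p : ℝ) (g : ℝ → ℝ) (s : ℝ) : ℝ :=
  s ^ a * (s * deriv g s ^ 2 + 2 / (p + 1) * g s ^ (p + 1) + 2 * a / (p + 1) * (g s * deriv g s))

namespace IsGlobalPosLaneEmdenSolution

variable {a p : ℝ} {g : ℝ → ℝ} {s : ℝ}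

theorem hasDerivAt (hg : IsGlobalPosLaneEmdenSolution a p g) (hs : 0 ≤ s) :
    HasDerivAt g (deriv g s) s :=
  ((hg.contDiffAt s hs).differentiableAt two_ne_zero).hasDerivAt

theorem hasDerivAt_deriv (hg : IsGlobalPosLaneEmdenSolution a p g) (hs : 0 ≤ s) :
    HasDerivAt (deriv g) (deriv (deriv g) s) s :=
  (((hg.contDiffAt s hs).derivWithin one_add_one_eq_two.le).differentiableAt
    one_ne_zero).hasDerivAt

theorem continuousOn (hg : IsGlobalPosLaneEmdenSolution a p g) : ContinuousOn g (Ici 0) :=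
  fun _ hs => (hg.hasDerivAt hs).continuousAt.continuousWithinAt

theorem continuousOn_deriv (hg : IsGlobalPosLaneEmdenSolution a p g) :
    ContinuousOn (deriv g) (Ici 0) :=
  fun _ hs => (hg.hasDerivAt_deriv hs).continuousAt.continuousWithinAt

theorem hasDerivAt_rpow_mul_deriv (hg : IsGlobalPosLaneEmdenSolution a p g) (hs : 0 < s) :
    HasDerivAt (fun t => t ^ a * deriv g t) (-(s ^ (a - 1) * g s ^ p)) s := by
  refine ((Real.hasDerivAt_rpow_const (Or.inl hs.ne')).mul
    (hg.hasDerivAt_deriv hs.le)).congr_deriv ?_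
  have hsa : s ^ a = s ^ (a - 1) * s := by rw [← Real.rpow_add_one hs.ne', sub_add_cancel]
  rw [hsa]
  linear_combination s ^ (a - 1) * hg.ode s hs

theorem continuousOn_rpow_mul_deriv (hg : IsGlobalPosLaneEmdenSolution a p g) (ha : 0 < a) :
    ContinuousOn (fun t => t ^ a * deriv g t) (Ici 0) :=
  (Real.continuous_rpow_const ha.le).continuousOn.mul hg.continuousOn_deriv

theorem strictAntiOn_rpow_mul_deriv (hg : IsGlobalPosLaneEmdenSolution a p g) (ha : 0 < a) :
    StrictAntiOn (fun t => t ^ a * deriv g t) (Ici 0) := by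
  refine strictAntiOn_of_deriv_neg (convex_Ici 0) (hg.continuousOn_rpow_mul_deriv ha)
    fun t ht => ?_
  rw [interior_Ici, mem_Ioi] at ht
  rw [(hg.hasDerivAt_rpow_mul_deriv ht).deriv, neg_lt_zero]
  exact mul_pos (Real.rpow_pos_of_pos ht _) (Real.rpow_pos_of_pos (hg.pos t ht.le) _)

theorem deriv_neg (hg : IsGlobalPosLaneEmdenSolution a p g) (ha : 0 < a) (hs : 0 < s) :
    deriv g s < 0 := by
  have hflux := hg.strictAntiOn_rpow_mul_deriv ha self_mem_Ici (mem_Ici.2 hs.le) hs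
  simp only [Real.zero_rpow ha.ne', zero_mul] at hflux
  exact (pos_iff_neg_of_mul_neg hflux).1 (Real.rpow_pos_of_pos hs a)

theorem antitoneOn (hg : IsGlobalPosLaneEmdenSolution a p g) (ha : 0 < a) :
    AntitoneOn g (Ici 0) := by
  refine (strictAntiOn_of_deriv_neg (convex_Ici 0) hg.continuousOn fun t ht => ?_).antitoneOn
  rw [interior_Ici, mem_Ioi] at ht
  exact hg.deriv_neg ha ht

theorem deriv_le (hg : IsGlobalPosLaneEmdenSolution a p g) (ha : 0 < a) (hp : 0 ≤ p)
    (hs : 0 < s) : deriv g s ≤ -(g s ^ p / a) := by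
  have hderiv (t : ℝ) (ht : 0 < t) : HasDerivAt (fun t => t ^ a * deriv g t + t ^ a * (g s ^ p / a))
      (t ^ (a - 1) * (g s ^ p - g t ^ p)) t := by
    refine ((hg.hasDerivAt_rpow_mul_deriv ht).add
      ((Real.hasDerivAt_rpow_const (Or.inl ht.ne')).mul_const _)).congr_deriv ?_
    field_simp
    ring
  have hanti : AntitoneOn (fun t => t ^ a * deriv g t + t ^ a * (g s ^ p / a)) (Icc 0 s) := by
    refine antitoneOn_of_deriv_nonpos (convex_Icc 0 s)
      (((hg.continuousOn_rpow_mul_deriv ha).mono Icc_subset_Ici_self).add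
        ((Real.continuous_rpow_const ha.le).continuousOn.mul continuousOn_const))
      ?_ fun t ht => ?_
    all_goals rw [interior_Icc] at *
    · exact fun t ht => (hderiv t ht.1).differentiableAt.differentiableWithinAt
    rw [(hderiv t ht.1).deriv]
    refine mul_nonpos_of_nonneg_of_nonpos (Real.rpow_nonneg ht.1.le _) (sub_nonpos.2 ?_)
    exact Real.rpow_le_rpow (hg.pos s hs.le).le
      (hg.antitoneOn ha (mem_Ici.2 ht.1.le) (mem_Ici.2 hs.le) ht.2.le) hp
  have hle := hanti (left_mem_Icc.2 hs.le) (right_mem_Icc.2 hs.le) hs.le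
  simp only [Real.zero_rpow ha.ne', zero_mul, add_zero, ← mul_add] at hle
  linarith [nonpos_of_mul_nonpos_right hle (Real.rpow_pos_of_pos hs a)]

theorem monotoneOn_rpow_one_sub_sub (hg : IsGlobalPosLaneEmdenSolution a p g) (ha : 0 < a)
    (hp : 1 < p) : MonotoneOn (fun s => g s ^ (1 - p) - (p - 1) / a * s) (Ici 0) := by
  have hderiv (t : ℝ) (ht : 0 < t) : HasDerivAt (fun s => g s ^ (1 - p) - (p - 1) / a * s)
      ((p - 1) * (g t ^ (-p) * -(deriv g t) - 1 / a)) t := by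
    refine (((hg.hasDerivAt ht.le).rpow_const (p := 1 - p) (Or.inl (hg.pos t ht.le).ne')).sub
      ((hasDerivAt_id t).const_mul ((p - 1) / a))).congr_deriv ?_
    rw [show 1 - p - 1 = -p by ring]
    ring
  refine monotoneOn_of_deriv_nonneg (convex_Ici 0)
    ((hg.continuousOn.rpow_const fun t ht => Or.inl (hg.pos t ht).ne').sub (by fun_prop))
    ?_ fun t ht => ?_
  all_goals rw [interior_Ici] at *
  · exact fun t ht => (hderiv t ht).differentiableAt.differentiableWithinAt
  rw [(hderiv t ht).deriv]
  have ht0 : 0 < t := ht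
  have hgp : 0 < g t ^ p := Real.rpow_pos_of_pos (hg.pos t ht0.le) p
  refine mul_nonneg (by linarith) (sub_nonneg.2 ?_)
  calc 1 / a = g t ^ (-p) * (g t ^ p / a) := by
        rw [Real.rpow_neg (hg.pos t ht0.le).le]; field_simp
    _ ≤ g t ^ (-p) * -deriv g t := by
        gcongr
        · exact Real.rpow_nonneg (hg.pos t ht0.le).le _
        · linarith [hg.deriv_le ha (by linarith) ht0]

theorem mul_rpow_sub_one_le (hg : IsGlobalPosLaneEmdenSolution a p g) (ha : 0 < a) (hp : 1 < p)
    (hs : 0 < s) : s * g s ^ (p - 1) ≤ a / (p - 1) := by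
  have hp' : 0 < p - 1 := sub_pos.2 hp
  have hgs : 0 < g s ^ (p - 1) := Real.rpow_pos_of_pos (hg.pos s hs.le) _
  have hmono := hg.monotoneOn_rpow_one_sub_sub ha hp self_mem_Ici (mem_Ici.2 hs.le) hs.le
  have hg0 : 0 < g 0 ^ (1 - p) := Real.rpow_pos_of_pos (hg.pos 0 le_rfl) _
  have hinv : (p - 1) / a * s ≤ (g s ^ (p - 1))⁻¹ := by
    rw [← Real.rpow_neg (hg.pos s hs.le).le, neg_sub]
    simp only [mul_zero, sub_zero] at hmono
    linarith
  rw [le_div_iff₀ hp']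
  rw [le_inv_comm₀ (by positivity) hgs, le_inv_comm₀ hgs (by positivity), ← one_div,
    le_div_iff₀ hgs] at hinv
  field_simp at hinv
  linarith

theorem mul_neg_deriv_le (hg : IsGlobalPosLaneEmdenSolution a p g) (ha : 0 < a) (hs : 0 < s) :
    s * -deriv g s ≤ 2 ^ a * g s := by
  obtain ⟨ξ, ⟨hsξ, hξ⟩, hslope⟩ := exists_deriv_eq_slope g (show s < 2 * s by linarith)
    (hg.continuousOn.mono fun t ht => mem_Ici.2 (hs.le.trans ht.1))
    fun t ht => (hg.hasDerivAt (hs.le.trans ht.1.le)).differentiableAt.differentiableWithinAt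
  have hξ0 : 0 < ξ := hs.trans hsξ
  have hflux := hg.strictAntiOn_rpow_mul_deriv ha (mem_Ici.2 hs.le) (mem_Ici.2 hξ0.le) hsξ
  have hratio : ξ ^ a ≤ s ^ a * 2 ^ a := by
    rw [← Real.mul_rpow hs.le zero_le_two]
    exact Real.rpow_le_rpow hξ0.le (by linarith) ha.le
  have hderiv : -deriv g s ≤ 2 ^ a * -deriv g ξ := by
    refine le_of_mul_le_mul_left ?_ (Real.rpow_pos_of_pos hs a)
    linarith [mul_le_mul_of_nonneg_right hratio (neg_nonneg.2 (hg.deriv_neg ha hξ0).le)]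
  have hdrop : s * -deriv g ξ ≤ g s := by
    rw [eq_div_iff (by linarith)] at hslope
    linarith [hg.pos (2 * s) (by linarith)]
  calc s * -deriv g s ≤ s * (2 ^ a * -deriv g ξ) := mul_le_mul_of_nonneg_left hderiv hs.le
    _ = 2 ^ a * (s * -deriv g ξ) := by ring
    _ ≤ 2 ^ a * g s := by gcongr

theorem hasDerivAt_pohozaev (hg : IsGlobalPosLaneEmdenSolution a p g) (hp : p + 1 ≠ 0)
    (hs : 0 < s) : HasDerivAt (pohozaev a p g)
      ((1 - a + 2 * a / (p + 1)) * (s ^ a * deriv g s ^ 2)) s := by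
  have hgs : 0 < g s := hg.pos s hs.le
  have hd := hg.hasDerivAt hs.le
  have hdd := hg.hasDerivAt_deriv hs.le
  have hpow : HasDerivAt (fun t => g t ^ (p + 1)) (deriv g s * (p + 1) * g s ^ (p + 1 - 1)) s :=
    hd.rpow_const (Or.inl hgs.ne')
  refine ((Real.hasDerivAt_rpow_const (p := a) (Or.inl hs.ne')).mul
    ((((hasDerivAt_id s).mul (hdd.pow 2)).add (hpow.const_mul (2 / (p + 1)))).add
      ((hd.mul hdd).const_mul (2 * a / (p + 1))))).congr_deriv ?_
  have hgp : g s ^ p = -(s * deriv (deriv g) s + a * deriv g s) := by rw [hg.ode s hs, neg_neg]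
  have hsa : s ^ a = s ^ (a - 1) * s := by rw [← Real.rpow_add_one hs.ne', sub_add_cancel]
  simp only [Pi.add_apply, Pi.mul_apply, Pi.pow_apply, id, Real.rpow_add_one hgs.ne',
    add_sub_cancel_right, hsa, hgp]
  field_simp
  ring

theorem strictMonoOn_pohozaev (hg : IsGlobalPosLaneEmdenSolution a p g) (ha : 0 < a) (hp : 1 < p)
    (hsub : a * (p - 1) < p + 1) : StrictMonoOn (pohozaev a p g) (Ici 0) := by
  have hp1 : 0 < p + 1 := by linarith
  refine strictMonoOn_of_deriv_pos (convex_Ici 0) ?_ fun t ht => ?_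
  · exact (Real.continuous_rpow_const ha.le).continuousOn.mul
      (((continuousOn_id.mul (hg.continuousOn_deriv.pow 2)).add
        ((hg.continuousOn.rpow_const fun t ht => Or.inl (hg.pos t ht).ne').const_mul _)).add
        ((hg.continuousOn.mul hg.continuousOn_deriv).const_mul _))
  · rw [interior_Ici, mem_Ioi] at ht
    rw [(hg.hasDerivAt_pohozaev hp1.ne' ht).deriv]
    have hcoef : 1 - a + 2 * a / (p + 1) = (p + 1 - a * (p - 1)) / (p + 1) := by
      field_simp
      ring
    rw [hcoef]
    exact mul_pos (div_pos (sub_pos.2 hsub) hp1)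
      (mul_pos (Real.rpow_pos_of_pos ht a) (sq_pos_of_neg (hg.deriv_neg ha ht)))

theorem pohozaev_le (hg : IsGlobalPosLaneEmdenSolution a p g) (ha : 0 < a) (hp : 1 < p)
    (hs : 0 < s) : pohozaev a p g s ≤
      ((2 ^ a) ^ 2 + 2 / (p + 1) * (a / (p - 1))) * (s ^ (a - 1) * g s ^ 2) := by
  have hgs : 0 < g s := hg.pos s hs.le
  have hneg := hg.deriv_neg ha hs
  have hkinetic : s * (s * deriv g s ^ 2) ≤ (2 ^ a) ^ 2 * g s ^ 2 := by
    have hsq := pow_le_pow_left₀ (mul_nonneg hs.le (neg_nonneg.2 hneg.le))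
      (hg.mul_neg_deriv_le ha hs) 2
    linarith
  have hpotential : s * g s ^ (p + 1) ≤ a / (p - 1) * g s ^ 2 := by
    have hsplit : g s ^ (p + 1) = g s ^ (p - 1) * g s ^ 2 := by
      rw [← Real.rpow_two, ← Real.rpow_add hgs]; ring_nf
    rw [hsplit, ← mul_assoc]
    exact mul_le_mul_of_nonneg_right (hg.mul_rpow_sub_one_le ha hp hs) (sq_nonneg _)
  have hmixed : s * (2 * a / (p + 1) * (g s * deriv g s)) ≤ 0 := by
    refine mul_nonpos_of_nonneg_of_nonpos hs.le (mul_nonpos_of_nonneg_of_nonpos (by positivity) ?_)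
    exact (mul_neg_of_pos_of_neg hgs hneg).le
  calc pohozaev a p g s
      = s ^ (a - 1) * (s * (s * deriv g s ^ 2) + 2 / (p + 1) * (s * g s ^ (p + 1))
          + s * (2 * a / (p + 1) * (g s * deriv g s))) := by
        have hsa : s ^ a = s ^ (a - 1) * s := by rw [← Real.rpow_add_one hs.ne', sub_add_cancel]
        rw [pohozaev, hsa]
        ring
    _ ≤ s ^ (a - 1) * ((2 ^ a) ^ 2 * g s ^ 2 + 2 / (p + 1) * (a / (p - 1) * g s ^ 2) + 0) := by
        gcongr
    _ = _ := by ring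

theorem sq_le (hg : IsGlobalPosLaneEmdenSolution a p g) (ha : 0 < a) (hp : 1 < p) (hs : 0 < s) :
    g s ^ 2 ≤ (a / (p - 1)) ^ (2 / (p - 1)) * s ^ (-(2 / (p - 1))) := by
  have hp' : 0 < p - 1 := sub_pos.2 hp
  have hgs : 0 < g s := hg.pos s hs.le
  calc g s ^ 2 = (g s ^ (p - 1)) ^ (2 / (p - 1)) := by
        rw [← Real.rpow_mul hgs.le, mul_div_cancel₀ _ hp'.ne', Real.rpow_two]
    _ ≤ (a / (p - 1) / s) ^ (2 / (p - 1)) := by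
        refine Real.rpow_le_rpow (Real.rpow_nonneg hgs.le _) ?_ (by positivity)
        rw [le_div_iff₀' hs]
        exact hg.mul_rpow_sub_one_le ha hp hs
    _ = _ := by
        rw [Real.div_rpow (by positivity) hs.le, Real.rpow_neg hs.le, div_eq_mul_inv]

theorem tendsto_rpow_mul_sq (hg : IsGlobalPosLaneEmdenSolution a p g) (ha : 0 < a) (hp : 1 < p)
    (hsub : a * (p - 1) < p + 1) :
    Tendsto (fun s => s ^ (a - 1) * g s ^ 2) atTop (𝓝 0) := by
  have hp' : 0 < p - 1 := sub_pos.2 hp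
  have hexp : 0 < (p + 1) / (p - 1) - a := by rwa [sub_pos, lt_div_iff₀ hp']
  have hlim := (tendsto_rpow_neg_atTop hexp).const_mul ((a / (p - 1)) ^ (2 / (p - 1)))
  rw [mul_zero] at hlim
  refine squeeze_zero' ?_ ?_ hlim
  all_goals filter_upwards [eventually_gt_atTop 0] with s hs
  · exact mul_nonneg (Real.rpow_nonneg hs.le _) (sq_nonneg _)
  · calc s ^ (a - 1) * g s ^ 2
        ≤ s ^ (a - 1) * ((a / (p - 1)) ^ (2 / (p - 1)) * s ^ (-(2 / (p - 1)))) := by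
          gcongr
          exact hg.sq_le ha hp hs
      _ = (a / (p - 1)) ^ (2 / (p - 1)) * s ^ (a - 1 + -(2 / (p - 1))) := by
          rw [Real.rpow_add hs]; ring
      _ = _ := by
          congr 2
          field_simp
          ring

end IsGlobalPosLaneEmdenSolution

theorem not_isGlobalPosLaneEmdenSolution {a p : ℝ} (ha : 0 < a) (hp : 1 < p)
    (hsub : a * (p - 1) < p + 1) (g : ℝ → ℝ) : ¬IsGlobalPosLaneEmdenSolution a p g := by
  intro hg
  have hmono := hg.strictMonoOn_pohozaev ha hp hsub
  have hzero : pohozaev a p g 0 = 0 := by rw [pohozaev, Real.zero_rpow ha.ne', zero_mul]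
  have hone : 0 < pohozaev a p g 1 := hzero ▸ hmono self_mem_Ici (mem_Ici.2 zero_le_one) one_pos
  have hlim := (hg.tendsto_rpow_mul_sq ha hp hsub).const_mul
    ((2 ^ a) ^ 2 + 2 / (p + 1) * (a / (p - 1)))
  rw [mul_zero] at hlim
  obtain ⟨s, hsmall, hs⟩ :=
    ((hlim.eventually_lt_const hone).and (eventually_ge_atTop 1)).exists
  have hs0 : 0 < s := one_pos.trans_le hs
  exact (((hmono.monotoneOn (mem_Ici.2 zero_le_one) (mem_Ici.2 hs0.le) hs).trans
    (hg.pohozaev_le ha hp hs0)).trans_lt hsmall).false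

end GlobalPositiveSolutions

section TruncatedProblem

/-- The power `|v| ^ p` truncated at `|v| = 2`, a globally Lipschitz nonlinearity agreeing with
`v ^ p` for `0 ≤ v ≤ 2`; solutions starting from the value `1` stay in the range where the two
agree until they vanish. -/
noncomputable def truncRpow (p v : ℝ) : ℝ := min |v| 2 ^ p

theorem truncRpow_nonneg (p v : ℝ) : 0 ≤ truncRpow p v :=
  Real.rpow_nonneg (le_min (abs_nonneg v) zero_le_two) p

theorem truncRpow_pos (p : ℝ) {v : ℝ} (hv : v ≠ 0) : 0 < truncRpow p v :=
  Real.rpow_pos_of_pos (lt_min (abs_pos.2 hv) two_pos) p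

theorem truncRpow_of_abs_le_two (p : ℝ) {v : ℝ} (hv : |v| ≤ 2) : truncRpow p v = |v| ^ p := by
  rw [truncRpow, min_eq_left hv]

theorem truncRpow_of_mem_Icc (p : ℝ) {v : ℝ} (hv : v ∈ Icc 0 2) : truncRpow p v = v ^ p := by
  rw [truncRpow_of_abs_le_two p (abs_le.2 ⟨by linarith [hv.1], hv.2⟩), abs_of_nonneg hv.1]

theorem exists_lipschitzWith_truncRpow {p : ℝ} (hp : 1 ≤ p) :
    ∃ L, LipschitzWith L (truncRpow p) := by
  obtain ⟨L, hL⟩ := (Real.contDiff_rpow_const_of_le (n := 1) (by simpa using hp)).contDiffOn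
    |>.exists_lipschitzOnWith one_ne_zero (convex_Icc (0 : ℝ) 2) isCompact_Icc
  have htrunc : LipschitzWith 1 fun v : ℝ => min |v| 2 := lipschitzWith_one_norm.min_const 2
  refine ⟨L * 1, lipschitzOnWith_univ.1 (hL.comp htrunc.lipschitzOnWith fun v _ => ?_)⟩
  exact ⟨le_min (abs_nonneg v) zero_le_two, min_le_right _ _⟩

theorem contDiffOn_one_truncRpow {p : ℝ} (hp : 1 < p) :
    ContDiffOn ℝ 1 (truncRpow p) (Ioo (-2) 2) :=
  (contDiff_norm_rpow hp).contDiffOn.congr fun _ hv =>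
    truncRpow_of_abs_le_two p (abs_le.2 ⟨hv.1.le, hv.2.le⟩)

theorem contDiffOn_truncRpow (p : ℝ) (n : ℕ∞ω) : ContDiffOn ℝ n (truncRpow p) (Ioo 0 2) :=
  (contDiffOn_id.rpow_const_of_ne fun _ hv => hv.1.ne').congr fun _ hv =>
    truncRpow_of_mem_Icc p (Ioo_subset_Icc_self hv)

theorem exists_first_zero {g : ℝ → ℝ} (hg : Continuous g) (hg0 : 0 < g 0)
    (hneg : ∃ s, 0 ≤ s ∧ g s ≤ 0) :
    ∃ s₀, 0 < s₀ ∧ g s₀ = 0 ∧ ∀ s ∈ Ico 0 s₀, 0 < g s := by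
  set S : Set ℝ := {s | 0 ≤ s ∧ g s ≤ 0}
  have hclosed : IsClosed S := isClosed_Ici.inter (isClosed_Iic.preimage hg)
  have hbdd : BddBelow S := ⟨0, fun s hs => hs.1⟩
  obtain ⟨hinf, hginf⟩ : sInf S ∈ S := hclosed.csInf_mem hneg hbdd
  obtain ⟨t, ht, hgt⟩ := intermediate_value_Icc' hinf hg.continuousOn ⟨hginf, hg0.le⟩
  obtain rfl : t = sInf S := le_antisymm ht.2 (csInf_le hbdd ⟨ht.1, hgt.le⟩)
  refine ⟨sInf S, hinf.lt_of_ne fun h => ?_, hgt, fun s hs => ?_⟩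
  · rw [← h] at hgt
    exact hg0.ne' hgt
  · by_contra! hgs
    exact (csInf_le hbdd ⟨hs.1, hgs⟩).not_gt hs.2

/-- `g` solves the truncated initial value problem `s g'' + a g' = -truncRpow p g`, `g 0 = 1`, in
its integrated form, which makes sense on both sides of the singular point `s = 0`. -/
structure IsTruncatedSolution (a p : ℝ) (g : ℝ → ℝ) : Prop where
  apply_zero : g 0 = 1
  hasDerivAt : ∀ s, HasDerivAt g (-weightedMean a (truncRpow p ∘ g) s) s

theorem exists_isTruncatedSolution {a p : ℝ} (ha : 0 < a) (hp : 1 ≤ p) :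
    ∃ g, IsTruncatedSolution a p g := by
  obtain ⟨L, hL⟩ := exists_lipschitzWith_truncRpow hp
  obtain ⟨g, hg0, hg⟩ := exists_hasDerivAt_neg_weightedMean_comp ha hL 1
  exact ⟨g, hg0, hg⟩

namespace IsTruncatedSolution

variable {a p : ℝ} {g : ℝ → ℝ} {s : ℝ}

theorem continuous (hg : IsTruncatedSolution a p g) : Continuous g :=
  continuous_iff_continuousAt.2 fun s => (hg.hasDerivAt s).continuousAt

theorem antitone (hg : IsTruncatedSolution a p g) : Antitone g :=
  antitone_of_hasDerivAt_nonpos hg.hasDerivAt fun _ =>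
    neg_nonpos.2 (weightedMean_nonneg fun _ => truncRpow_nonneg p _)

theorem le_one (hg : IsTruncatedSolution a p g) (hs : 0 ≤ s) : g s ≤ 1 :=
  hg.apply_zero ▸ hg.antitone hs

theorem isOpen_preimage_Ioo (hg : IsTruncatedSolution a p g) (u v : ℝ) :
    IsOpen (g ⁻¹' Ioo u v) :=
  isOpen_Ioo.preimage hg.continuous

theorem starConvex_preimage_Ioo (hg : IsTruncatedSolution a p g) {u v : ℝ} (hu : u < 1)
    (hv : 1 < v) : StarConvex ℝ 0 (g ⁻¹' Ioo u v) := by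
  refine (ordConnected_Ioo.preimage_anti hg.antitone).convex.starConvex ?_
  rw [mem_preimage, hg.apply_zero]
  exact ⟨hu, hv⟩

theorem contDiffAt_two (hg : IsTruncatedSolution a p g) (ha : 0 < a) (hp : 1 < p)
    (hgs : g s ∈ Ioo (-2) 2) : ContDiffAt ℝ 2 g s := by
  have hsucc := contDiffOn_succ_of_hasDerivAt_neg_weightedMean ha (hg.isOpen_preimage_Ioo _ _)
    (hg.starConvex_preimage_Ioo (by norm_num) one_lt_two) (fun s _ => hg.hasDerivAt s)
    (mapsTo_preimage g _) (n := 1) (contDiffOn_one_truncRpow hp)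
  exact (hsucc.of_le one_add_one_eq_two.ge).contDiffAt
    ((hg.isOpen_preimage_Ioo _ _).mem_nhds hgs)

theorem contDiffAt_infty (hg : IsTruncatedSolution a p g) (ha : 0 < a) (hgs : g s ∈ Ioo 0 2) :
    ContDiffAt ℝ ∞ g s := by
  have hsmooth : ContDiffOn ℝ ∞ g (g ⁻¹' Ioo 0 2) := contDiffOn_infty.2 fun n =>
    (contDiffOn_succ_of_hasDerivAt_neg_weightedMean ha (hg.isOpen_preimage_Ioo _ _)
      (hg.starConvex_preimage_Ioo one_pos one_lt_two) (fun s _ => hg.hasDerivAt s)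
      (mapsTo_preimage g _) (contDiffOn_truncRpow p n)).of_le le_self_add
  exact hsmooth.contDiffAt ((hg.isOpen_preimage_Ioo _ _).mem_nhds hgs)

theorem ode (hg : IsTruncatedSolution a p g) (ha : 0 < a) (hp : 1 < p) (hgs : g s ∈ Ico 0 2) :
    s * deriv (deriv g) s + a * deriv g s = -g s ^ p := by
  rw [← truncRpow_of_mem_Icc p (Ico_subset_Icc_self hgs)]
  exact mul_deriv_deriv_add_of_hasDerivAt_neg_weightedMean ha (hg.isOpen_preimage_Ioo (-2) 2)
    (hg.starConvex_preimage_Ioo (by norm_num) one_lt_two) (fun s _ => hg.hasDerivAt s)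
    (mapsTo_preimage g _) (contDiffOn_one_truncRpow hp) ⟨by linarith [hgs.1], hgs.2⟩

theorem strictAntiOn (hg : IsTruncatedSolution a p g) (ha : 0 < a) (hp : 1 ≤ p) {s₀ : ℝ}
    (hpos : ∀ s ∈ Ico 0 s₀, 0 < g s) : StrictAntiOn g (Icc 0 s₀) := by
  refine strictAntiOn_of_deriv_neg (convex_Icc 0 s₀) hg.continuous.continuousOn fun s hs => ?_
  rw [interior_Icc] at hs
  rw [(hg.hasDerivAt s).deriv, neg_lt_zero]
  obtain ⟨L, hL⟩ := exists_lipschitzWith_truncRpow hp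
  have hcont : Continuous (truncRpow p ∘ g) := hL.continuous.comp hg.continuous
  refine weightedMean_pos ha (hcont.comp (by fun_prop)).continuousOn fun τ hτ =>
    truncRpow_pos p (hpos _ ?_).ne'
  exact ⟨(mul_pos hs.1 hτ.1).le, (mul_le_of_le_one_right hs.1.le hτ.2.le).trans_lt hs.2⟩

theorem exists_nonpos (hg : IsTruncatedSolution a p g) (ha : 0 < a) (hp : 1 < p)
    (hsub : a * (p - 1) < p + 1) : ∃ s, 0 ≤ s ∧ g s ≤ 0 := by
  by_contra! hpos
  have hlt_two (s : ℝ) (hs : 0 ≤ s) : g s < 2 := (hg.le_one hs).trans_lt one_lt_two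
  exact not_isGlobalPosLaneEmdenSolution ha hp hsub g
    { contDiffAt := fun s hs =>
        hg.contDiffAt_two ha hp ⟨by linarith [hpos s hs], hlt_two s hs⟩
      pos := hpos
      ode := fun s hs => hg.ode ha hp ⟨(hpos s hs.le).le, hlt_two s hs.le⟩ }

end IsTruncatedSolution

end TruncatedProblem

section Profile

/-- `g` is a positive decreasing solution of `s g'' + a g' = -b g ^ p` on `[0, s₀)`, smooth there
and `C²` up to its first zero `s₀`. With `s = |x| ^ 2` it is the profile of a radial solution in
the ball of radius `√s₀`. -/
structure IsLaneEmdenProfile (a b p : ℝ) (g : ℝ → ℝ) (s₀ : ℝ) : Prop where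
  contDiffAt_infty : ∀ s ∈ Ico 0 s₀, ContDiffAt ℝ ∞ g s
  contDiffAt_two : ∀ s ∈ Icc 0 s₀, ContDiffAt ℝ 2 g s
  pos : ∀ s ∈ Ico 0 s₀, 0 < g s
  eq_zero : g s₀ = 0
  strictAntiOn : StrictAntiOn g (Icc 0 s₀)
  ode : ∀ s ∈ Ico 0 s₀, s * deriv (deriv g) s + a * deriv g s = -(b * g s ^ p)

variable {a b p : ℝ}

theorem IsTruncatedSolution.isLaneEmdenProfile {g : ℝ → ℝ} (hg : IsTruncatedSolution a p g)
    (ha : 0 < a) (hp : 1 < p) {s₀ : ℝ} (hzero : g s₀ = 0) (hpos : ∀ s ∈ Ico 0 s₀, 0 < g s) :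
    IsLaneEmdenProfile a 1 p g s₀ where
  contDiffAt_infty s hs :=
    hg.contDiffAt_infty ha ⟨hpos s hs, (hg.le_one hs.1).trans_lt one_lt_two⟩
  contDiffAt_two s hs := by
    have hnonneg : 0 ≤ g s := hzero ▸ hg.antitone hs.2
    exact hg.contDiffAt_two ha hp ⟨by linarith, (hg.le_one hs.1).trans_lt one_lt_two⟩
  pos := hpos
  eq_zero := hzero
  strictAntiOn := hg.strictAntiOn ha hp.le hpos
  ode s hs := by
    rw [one_mul]
    exact hg.ode ha hp ⟨(hpos s hs).le, (hg.le_one hs.1).trans_lt one_lt_two⟩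

theorem IsLaneEmdenProfile.const_mul_comp_mul {g : ℝ → ℝ} {k c s₀ : ℝ} (hk : 0 < k) (hc : 0 < c)
    (hg : IsLaneEmdenProfile a b p g (k * s₀)) :
    IsLaneEmdenProfile a (k * b * c ^ (1 - p)) p (fun t => c * g (k * t)) s₀ where
  contDiffAt_infty t ht := by
    have := hg.contDiffAt_infty (k * t) (by simpa [hk, hk.le] using ht)
    fun_prop
  contDiffAt_two t ht := by
    have := hg.contDiffAt_two (k * t) (by simpa [hk, hk.le] using ht)
    fun_prop
  pos t ht := mul_pos hc (hg.pos _ (by simpa [hk, hk.le] using ht))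
  eq_zero := by rw [hg.eq_zero, mul_zero]
  strictAntiOn t ht u hu htu := mul_lt_mul_of_pos_left
    (hg.strictAntiOn (by simpa [hk, hk.le] using ht) (by simpa [hk, hk.le] using hu)
      (mul_lt_mul_of_pos_left htu hk)) hc
  ode t ht := by
    have hkt : k * t ∈ Ico 0 (k * s₀) := by simpa [hk, hk.le] using ht
    have hderiv : deriv (fun t => c * g (k * t)) = fun t => c * (k * deriv g (k * t)) := by
      ext t
      simp only [deriv_const_mul_field, deriv_comp_mul_left, smul_eq_mul]
    have hderiv2 : deriv (fun t => c * (k * deriv g (k * t))) t =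
        c * (k * (k * deriv (deriv g) (k * t))) := by
      simp only [deriv_const_mul_field, deriv_comp_mul_left (f := deriv g), smul_eq_mul]
    have hcp : c ^ (1 - p) * c ^ p = c := by
      rw [← Real.rpow_add hc, sub_add_cancel, Real.rpow_one]
    rw [hderiv, hderiv2, Real.mul_rpow hc.le (hg.pos _ hkt).le]
    linear_combination c * k * hg.ode _ hkt + k * b * g (k * t) ^ p * hcp

theorem exists_isLaneEmdenProfile (ha : 0 < a) (hb : 0 < b) (hp : 1 < p)
    (hsub : a * (p - 1) < p + 1) : ∃ g, IsLaneEmdenProfile a b p g 1 := by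
  obtain ⟨g, hg⟩ := exists_isTruncatedSolution ha hp.le
  obtain ⟨s₀, hs₀, hzero, hpos⟩ := exists_first_zero hg.continuous
    (hg.apply_zero ▸ one_pos) (hg.exists_nonpos ha hp hsub)
  have hprofile := hg.isLaneEmdenProfile ha hp hzero hpos
  have hbs : 0 < b / s₀ := div_pos hb hs₀
  have hscale : s₀ * 1 * ((b / s₀) ^ (1 / (1 - p))) ^ (1 - p) = b := by
    rw [← Real.rpow_mul hbs.le, one_div_mul_cancel (by linarith), Real.rpow_one, mul_one,
      mul_div_cancel₀ _ hs₀.ne']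
  rw [← mul_one s₀] at hprofile
  exact ⟨_, hscale ▸ hprofile.const_mul_comp_mul hs₀ (Real.rpow_pos_of_pos hbs _)⟩

end Profile

section RadialFunctions

theorem hasFDerivAt_comp_norm_sq {E : Type*} [NormedAddCommGroup E] [InnerProductSpace ℝ E]
    {G : ℝ → ℝ} {G' : ℝ} {x : E} (hG : HasDerivAt G G' (‖x‖ ^ 2)) :
    HasFDerivAt (fun y : E => G (‖y‖ ^ 2)) ((2 * G') • innerSL ℝ x) x := by
  refine (hG.comp_hasFDerivAt x (hasStrictFDerivAt_norm_sq x).hasFDerivAt).congr_fderiv ?_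
  rw [← Nat.cast_smul_eq_nsmul ℝ, smul_smul, Nat.cast_ofNat, mul_comm]

theorem iteratedFDeriv_two_comp_norm_sq {E : Type*} [NormedAddCommGroup E]
    [InnerProductSpace ℝ E] {G : ℝ → ℝ} {x : E} (hG : ContDiffAt ℝ 2 G (‖x‖ ^ 2)) (u v : E) :
    iteratedFDeriv ℝ 2 (fun y : E => G (‖y‖ ^ 2)) x ![u, v] =
      4 * deriv (deriv G) (‖x‖ ^ 2) * ⟪x, u⟫ * ⟪x, v⟫ + 2 * deriv G (‖x‖ ^ 2) * ⟪u, v⟫ := by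
  have hG' : HasDerivAt (deriv G) (deriv (deriv G) (‖x‖ ^ 2)) (‖x‖ ^ 2) :=
    ((hG.derivWithin one_add_one_eq_two.le).differentiableAt one_ne_zero).hasDerivAt
  have hfderiv : fderiv ℝ (fun y : E => G (‖y‖ ^ 2)) =ᶠ[𝓝 x]
      fun y => (2 * deriv G (‖y‖ ^ 2)) • innerSL ℝ y := by
    have hcont : ContinuousAt (fun y : E => ‖y‖ ^ 2) x := by fun_prop
    filter_upwards [hcont.eventually (hG.eventually (by simp))] with y hy
    exact (hasFDerivAt_comp_norm_sq (hy.differentiableAt two_ne_zero).hasDerivAt).fderiv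
  obtain ⟨J, hJ⟩ : ∃ J : E →L[ℝ] E →L[ℝ] ℝ, ∀ y, J y = innerSL ℝ y := ⟨innerSL ℝ, fun _ => rfl⟩
  have hfderiv2 := ((hasFDerivAt_comp_norm_sq hG').const_mul 2).fun_smul J.hasFDerivAt (x := x)
  simp only [← hJ] at hfderiv
  rw [iteratedFDeriv_two_apply, hfderiv.fderiv_eq, hfderiv2.fderiv]
  simp only [Fin.isValue, Matrix.cons_val_zero, add_apply, smul_apply,
    ContinuousLinearMap.smulRight_apply, hJ, coe_innerSL_apply, smul_eq_mul, Matrix.cons_val_one,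
    Matrix.cons_val_fin_one]
  ring

theorem laplacian_comp_norm_sq {E : Type*} [NormedAddCommGroup E] [InnerProductSpace ℝ E]
    [FiniteDimensional ℝ E] {G : ℝ → ℝ} {x : E} (hG : ContDiffAt ℝ 2 G (‖x‖ ^ 2)) :
    Laplacian.laplacian (fun y : E => G (‖y‖ ^ 2)) x =
      4 * deriv (deriv G) (‖x‖ ^ 2) * ‖x‖ ^ 2 +
        2 * Module.finrank ℝ E * deriv G (‖x‖ ^ 2) := by
  set b := stdOrthonormalBasis ℝ E
  rw [InnerProductSpace.laplacian_eq_iteratedFDeriv_orthonormalBasis _ b]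
  simp only [iteratedFDeriv_two_comp_norm_sq hG, real_inner_self_eq_norm_sq, b.norm_eq_one,
    mul_assoc, ← pow_two, Finset.sum_add_distrib, ← Finset.mul_sum, b.sum_sq_inner_left]
  simp only [one_pow, Finset.sum_const, Finset.card_univ, Fintype.card_fin, nsmul_eq_mul, mul_one]
  ring

theorem sum_mul_secondPartial {N : ℕ} (u : EuclideanSpace ℝ (Fin N) → ℝ)
    (x y z : EuclideanSpace ℝ (Fin N)) :
    ∑ i, ∑ j, y i * z j * secondPartial u i j x = iteratedFDeriv ℝ 2 u x ![y, z] := by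
  have hsum (y : EuclideanSpace ℝ (Fin N)) : y = ∑ i, y i • EuclideanSpace.single i (1 : ℝ) := by
    simpa using ((EuclideanSpace.basisFun (Fin N) ℝ).sum_repr y).symm
  conv_rhs => rw [hsum y, hsum z]
  simp only [secondPartial, iteratedFDeriv_two_apply, Fin.isValue, Matrix.cons_val_zero,
    Matrix.cons_val_one, Matrix.cons_val_fin_one, mul_assoc, map_sum, map_smul, sum_apply,
    smul_apply, smul_eq_mul, Finset.mul_sum]
  rw [Finset.sum_comm]
  simp only [mul_left_comm]

theorem cordesOp_eq_laplacian_add {N : ℕ} (γ : ℝ) (u : EuclideanSpace ℝ (Fin N) → ℝ)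
    (x : EuclideanSpace ℝ (Fin N)) :
    cordesOp γ u x =
      Laplacian.laplacian u x + γ * (iteratedFDeriv ℝ 2 u x ![x, x] / ‖x‖ ^ 2) := by
  simp only [cordesOp, ← sum_mul_secondPartial, Finset.sum_div, div_mul_eq_mul_div]

theorem cordesOp_comp_norm_sq {N : ℕ} (γ : ℝ) {G : ℝ → ℝ} {x : EuclideanSpace ℝ (Fin N)}
    (hx : x ≠ 0) (hG : ContDiffAt ℝ 2 G (‖x‖ ^ 2)) :
    cordesOp γ (fun y => G (‖y‖ ^ 2)) x =
      4 * (1 + γ) * (‖x‖ ^ 2 * deriv (deriv G) (‖x‖ ^ 2)) +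
        2 * (N + γ) * deriv G (‖x‖ ^ 2) := by
  have hx' : ‖x‖ ≠ 0 := norm_ne_zero_iff.2 hx
  rw [cordesOp_eq_laplacian_add, laplacian_comp_norm_sq hG, iteratedFDeriv_two_comp_norm_sq hG,
    finrank_euclideanSpace_fin, real_inner_self_eq_norm_sq]
  field_simp
  ring

end RadialFunctions

theorem IsLaneEmdenProfile.isPosSmoothRadialDecSolution {N : ℕ} {γ p : ℝ} {g : ℝ → ℝ}
    (hγ : -1 < γ)
    (hg : IsLaneEmdenProfile ((N + γ) / (2 * (1 + γ))) (1 / (4 * (1 + γ))) p g 1) :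
    IsPosSmoothRadialDecSolution N γ p fun x => g (‖x‖ ^ 2) := by
  have hball (x : EuclideanSpace ℝ (Fin N)) (hx : x ∈ ball 0 1) : ‖x‖ ^ 2 ∈ Ico 0 1 :=
    ⟨sq_nonneg _, pow_lt_one₀ (norm_nonneg x) (mem_ball_zero_iff.1 hx) two_ne_zero⟩
  have hIcc (r : ℝ) (hr : r ∈ Icc 0 1) : r ^ 2 ∈ Icc 0 1 := ⟨sq_nonneg r, pow_le_one₀ hr.1 hr.2⟩
  refine ⟨fun x hx => ?_, fun x hx => ?_, fun x hx => hg.pos _ (hball x hx),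
    ⟨fun r => g (r ^ 2), fun r hr t ht hrt => ?_, fun x _ => rfl⟩, fun x hx hx0 => ?_,
    fun x hx => ?_⟩
  · exact ((hg.contDiffAt_infty _ (hball x hx)).comp x
      (contDiff_norm_sq ℝ).contDiffAt).contDiffWithinAt
  · have hx1 : ‖x‖ ^ 2 ∈ Icc 0 1 := hIcc _ ⟨norm_nonneg x, mem_closedBall_zero_iff.1 hx⟩
    exact ((hg.contDiffAt_two _ hx1).comp x (contDiff_norm_sq ℝ).contDiffAt).contDiffWithinAt
  · exact hg.strictAntiOn (hIcc r hr) (hIcc t ht) (pow_lt_pow_left₀ hrt hr.1 two_ne_zero)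
  · have hode := hg.ode _ (hball x hx)
    rw [cordesOp_comp_norm_sq γ hx0 (hg.contDiffAt_two _ (Ico_subset_Icc_self (hball x hx)))]
    have hγ' : 0 < 1 + γ := by linarith
    field_simp at hode
    linarith
  · simp only [mem_sphere_zero_iff_norm.1 hx, one_pow, hg.eq_zero]

theorem theorem4_general {N : ℕ} (hN : 1 ≤ N) {γ p : ℝ} (hγ : -1 < γ) (hp : 1 < p)
    (hsub : p * (N - 2 - γ) < N + 2 + 3 * γ) :
    ∃ w : EuclideanSpace ℝ (Fin N) → ℝ, IsPosSmoothRadialDecSolution N γ p w := by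
  have hN' : (1 : ℝ) ≤ N := by exact_mod_cast hN
  have hγ' : 0 < 1 + γ := by linarith
  have hNγ : 0 < N + γ := by linarith
  have hsub' : (N + γ) / (2 * (1 + γ)) * (p - 1) < p + 1 := by
    rw [div_mul_eq_mul_div, div_lt_iff₀ (by positivity)]
    linarith
  obtain ⟨g, hg⟩ := exists_isLaneEmdenProfile (b := 1 / (4 * (1 + γ))) (by positivity)
    (by positivity) hp hsub'
  exact ⟨_, hg.isPosSmoothRadialDecSolution hγ⟩

theorem theorem4 (N : ℕ) (hN : 3 ≤ N) :
    (∀ γ p : ℝ, 0 < γ → γ < (N : ℝ) - 2 →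
      1 < p → p < ((N : ℝ) + 2 + 3 * γ) / ((N : ℝ) - 2 - γ) →
      ∃ w : EuclideanSpace ℝ (Fin N) → ℝ, IsPosSmoothRadialDecSolution N γ p w) ∧
    (∀ γ p : ℝ, (N : ℝ) - 2 ≤ γ → 1 < p →
      ∃ w : EuclideanSpace ℝ (Fin N) → ℝ, IsPosSmoothRadialDecSolution N γ p w) := by
  have hN' : (3 : ℝ) ≤ N := by exact_mod_cast hN
  refine ⟨fun γ p hγ hγN hp hpc => ?_, fun γ p hγN hp => ?_⟩
  · rw [lt_div_iff₀ (by linarith)] at hpc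
    exact theorem4_general (by lia) (by linarith) hp hpc
  · exact theorem4_general (by lia) (by linarith) hp (by nlinarith)
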